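/- For positive integers $i_1,\dots,i_k$ with $i_1\ge 2$, let $$t(i_1,\dots,i_k)=\sum_{\substack{n_1>n_2>\cdots>n_k\ge 1\\ n_j\ \mathrm{odd}}}\frac{1}{n_1^{i_1}n_2^{i_2}\cdots n_k^{i_k}}$$ denote the (convergent) multiple $t$-value, and write $t(3,\{2\}^N)=t(3,\underbrace{2,\dots,2}_{N})$. Let $\zeta$ be the Riemann zeta function and let $\eta(m)=(1-2^{1-m})\,\zeta(m)$ for integers $m\ge 2$ (the Dirichlet eta function). Then for every integer $N\ge 1$, $$t(3,\{2\}^N)=\frac{1}{2^{2N+2}}\left[\sum_{j=1}^{N}\frac{(-1)^{j+1}(2j)\,\pi^{2N+2-2j}}{(2N+2-2j)!}\,\eta(2j+1)+(-1)^N\,2\,(2N+2)\left(1-2^{-2N-3}\right)\zeta(2N+3)\right].$$ -/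

import Mathlib

/-- Index set of a depth `k` multiple `t`-value: tuples `n₁ > n₂ > ⋯ > n_k ≥ 1` of odd natural
numbers (an odd natural number is automatically at least `1`). -/
def MtvIndex (k : ℕ) : Type :=
  {n : Fin k → ℕ // StrictAnti n ∧ ∀ j, Odd (n j)}

/-- The summand `1 / (n₁ ^ i₁ ⋯ n_k ^ i_k)` of the multiple `t`-value with exponents `i`. -/
noncomputable def mtvTerm {k : ℕ} (i : Fin k → ℕ) (n : MtvIndex k) : ℝ :=
  1 / ∏ j, (n.1 j : ℝ) ^ i j

/-- The multiple `t`-value `t(i₁, …, i_k)`. -/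
noncomputable def mtv {k : ℕ} (i : Fin k → ℕ) : ℝ :=
  ∑' n : MtvIndex k, mtvTerm i n

/-- The index `(3, {2}^N) = (3, 2, …, 2)` with `N` twos. -/
def threeTwos (N : ℕ) : Fin (N + 1) → ℕ :=
  Fin.cons 3 (fun _ => 2)

/-- The Dirichlet eta function at natural numbers: `η(m) = (1 - 2^(1-m)) ζ(m)`, `η(1) = log 2`. -/
noncomputable def dirichletEta (m : ℕ) : ℂ :=
  if m = 1 then (Real.log 2 : ℂ) else (1 - (2 : ℂ) ^ (1 - (m : ℤ))) * riemannZeta m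

/-!
Write `e_N(n)` for the sum of `1 / (n₁ ⋯ n_N) ^ 2` over odd `n > n₁ > ⋯ > n_N ≥ 1`, so that
`t(3, {2}^N) = ∑ e_N(n) / n ^ 3` over odd `n` (`hasSum_mtvTerm_threeTwos`). The proof turns this
single series into an integral and evaluates the integral by a Fourier expansion.

If `b_n` are the Taylor coefficients of `arcsin`, then
`θ ^ (2 * N + 1) / (2 * N + 1)! = ∑ b_n e_N(n) sin θ ^ n` for `0 ≤ θ < π / 2`
(`hasSum_sin_pow_eq_pow_div_factorial`). This goes by induction on `N`: the second derivative of
`sin ^ n` is `n (n - 1) sin ^ (n - 2) - n ^ 2 sin ^ n`, and `e_{N+1}(n + 2) - e_{N+1}(n) =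
e_N(n) / n ^ 2`, so two integrations take the series for `N` to the one for `N + 1`. Since
`b_n ∫ (π / 2 - θ) cot θ sin θ ^ n = (b_n / n) ∫ sin θ ^ n = 1 / n ^ 3` on `[0, π / 2]` by Wallis'
recursion, integrating term by term gives (`hasSum_oddESymm_div_cube`)
`t(3, {2}^N) = ∫ (π / 2 - θ) cot θ · θ ^ (2 * N + 1) / (2 * N + 1)!`.

Finally `cot θ` is replaced by `∑ 2 sin (2 k θ)`: the partial sums differ from it by
`cos ((2 K + 1) θ) / sin θ`, which disappears in the limit by the Riemann–Lebesgue lemma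
(`tendsto_sum_integral_sin`). The resulting moments of `sin (2 k θ)` are found by repeated
integration by parts (`integral_sub_mul_pow_mul_sin`), and their sum over `k` consists of values
of `ζ` and `η`.
-/

section

open Filter Topology MeasureTheory intervalIntegral Finset

/-! ### Truncated sums -/

/-- The truncated multiple sum `∑ 1 / (n₁ ⋯ n_N) ^ 2` over odd `2 * M + 1 > n₁ > ⋯ > n_N ≥ 1`,
i.e. the `N`-th elementary symmetric function of `1 / (2 * k + 1) ^ 2` for `k < M`, defined by
recursion on the largest index. -/
noncomputable def oddESymm : ℕ → ℕ → ℝ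
  | 0, _ => 1
  | N + 1, M => ∑ k ∈ range M, oddESymm N k / (2 * (k : ℝ) + 1) ^ 2

lemma oddESymm_nonneg (N M : ℕ) : 0 ≤ oddESymm N M := by
  induction N generalizing M with
  | zero => simp [oddESymm]
  | succ N ih => exact sum_nonneg fun k _ => div_nonneg (ih k) (by positivity)

lemma oddESymm_succ_succ (N M : ℕ) :
    oddESymm (N + 1) (M + 1) = oddESymm (N + 1) M + oddESymm N M / (2 * (M : ℝ) + 1) ^ 2 := by
  simp [oddESymm, sum_range_succ]

lemma summable_one_div_odd_pow {m : ℕ} (hm : 2 ≤ m) :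
    Summable fun k : ℕ => 1 / (2 * (k : ℝ) + 1) ^ m := by
  have h := (Real.summable_one_div_nat_pow (p := m)).2 (by omega)
  simpa [Function.comp_def] using
    h.comp_injective (i := fun k : ℕ => 2 * k + 1) (fun a b hab => by simpa using hab)

lemma exists_oddESymm_le (N : ℕ) : ∃ C : ℝ, 0 ≤ C ∧ ∀ M, oddESymm N M ≤ C := by
  induction N with
  | zero => exact ⟨1, zero_le_one, fun M => le_rfl⟩
  | succ N ih =>
    obtain ⟨C, hC, h⟩ := ih
    refine ⟨∑' k : ℕ, C * (1 / (2 * (k : ℝ) + 1) ^ 2),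
      tsum_nonneg fun k => by positivity, fun M => ?_⟩
    refine le_trans (sum_le_sum fun k _ => ?_)
      (((summable_one_div_odd_pow le_rfl).mul_left C).sum_le_tsum (range M)
        fun k _ => by positivity)
    rw [mul_one_div]
    gcongr
    exact h k

lemma summable_oddESymm_div_cube (N : ℕ) :
    Summable fun M : ℕ => oddESymm N M / (2 * (M : ℝ) + 1) ^ 3 := by
  obtain ⟨C, -, h⟩ := exists_oddESymm_le N
  refine ((summable_one_div_odd_pow (m := 3) (by norm_num)).mul_left C).of_nonneg_of_le
    (fun M => div_nonneg (oddESymm_nonneg N M) (by positivity)) fun M => ?_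
  rw [mul_one_div]
  gcongr
  exact h M

/-- Strictly decreasing `k`-tuples of odd numbers `2 * m + 1` with `m ∈ s`. -/
def OddChain (k : ℕ) (s : Set ℕ) : Type :=
  {n : Fin k → ℕ // StrictAnti n ∧ ∀ j, ∃ m ∈ s, n j = 2 * m + 1}

/-- Prepending `2 * m + 1` to a chain all of whose entries are smaller. -/
def OddChain.cons {k : ℕ} {s : Set ℕ} (hs : IsLowerSet s)
    (x : Σ m : s, OddChain k (Set.Iio (m : ℕ))) : OddChain (k + 1) s :=
  ⟨Fin.cons (2 * (x.1 : ℕ) + 1) x.2.1, by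
    obtain ⟨⟨m, hm⟩, n, hn, hodd⟩ := x
    have hlt : ∀ j, n j < 2 * m + 1 := fun j => by
      obtain ⟨l, hl, h⟩ := hodd j
      have : l < m := hl
      simp only [h]; omega
    refine ⟨fun i j hij => ?_, fun j => ?_⟩
    · cases j using Fin.cases with
      | zero => exact absurd hij (Fin.not_lt_zero i)
      | succ j =>
        cases i using Fin.cases with
        | zero => simpa using hlt j
        | succ i => simpa using hn (Fin.succ_lt_succ_iff.1 hij)
    · cases j using Fin.cases with
      | zero => exact ⟨m, hm, by simp⟩
      | succ j =>
        obtain ⟨l, hl, h⟩ := hodd j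
        exact ⟨l, hs (le_of_lt hl) hm, by simpa using h⟩⟩

lemma OddChain.cons_bijective {k : ℕ} {s : Set ℕ} (hs : IsLowerSet s) :
    Function.Bijective (OddChain.cons (k := k) hs) := by
  constructor
  · rintro ⟨⟨m, hm⟩, n, hn⟩ ⟨⟨m', hm'⟩, n', hn'⟩ h
    have h : (Fin.cons (2 * m + 1) n : Fin (k + 1) → ℕ) = Fin.cons (2 * m' + 1) n' :=
      congrArg Subtype.val h
    obtain ⟨h1, rfl⟩ := Fin.cons_inj.1 h
    obtain rfl : m = m' := by simpa using h1
    rfl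
  · rintro ⟨n, hn, hodd⟩
    obtain ⟨m, hm, h0⟩ := hodd 0
    refine ⟨⟨⟨m, hm⟩, Fin.tail n, fun i j hij => hn (Fin.succ_lt_succ_iff.2 hij), fun j => ?_⟩, ?_⟩
    · obtain ⟨l, -, hl⟩ := hodd j.succ
      refine ⟨l, ?_, hl⟩
      have := hn (Fin.succ_pos j)
      simp only [Set.mem_Iio]
      omega
    · apply Subtype.ext
      simp only [OddChain.cons]
      rw [← h0]
      exact Fin.cons_self_tail n

/-- Summation over chains of nonnegative terms that factor through the largest entry. -/
lemma OddChain.hasSum_cons {k : ℕ} {s : Set ℕ} (hs : IsLowerSet s) {f : (Fin k → ℕ) → ℝ}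
    (hf : ∀ n, 0 ≤ f n) {g : ℕ → ℝ} (hg : ∀ m, 0 ≤ g m) {F : ℕ → ℝ} {a : ℝ}
    (hF : ∀ m, HasSum (fun n : OddChain k (Set.Iio m) => f n.1) (F m))
    (ha : HasSum (fun m : s => g m * F m) a) :
    HasSum (fun n : OddChain (k + 1) s => g (n.1 0 / 2) * f (Fin.tail n.1)) a := by
  rw [← (Equiv.ofBijective _ (OddChain.cons_bijective (k := k) hs)).hasSum_iff]
  have hval : ∀ x : Σ m : s, OddChain k (Set.Iio (m : ℕ)),
      ((fun n : OddChain (k + 1) s => g (n.1 0 / 2) * f (Fin.tail n.1)) ∘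
        Equiv.ofBijective _ (OddChain.cons_bijective (k := k) hs)) x = g x.1 * f x.2.1 := by
    intro x
    have : (2 * (x.1 : ℕ) + 1) / 2 = x.1 := by omega
    simp [OddChain.cons, this]
  rw [funext hval]
  have hfib : ∀ m : s, HasSum (fun n : OddChain k (Set.Iio (m : ℕ)) => g m * f n.1) (g m * F m) :=
    fun m => (hF m).mul_left _
  refine HasSum.sigma_of_hasSum ha hfib ?_
  rw [summable_sigma_of_nonneg fun x => mul_nonneg (hg _) (hf _)]
  refine ⟨fun m => (hfib m).summable, ?_⟩
  simp only [(hfib _).tsum_eq]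
  exact ha.summable

lemma OddChain.hasSum_twos (N M : ℕ) :
    HasSum (fun n : OddChain N (Set.Iio M) => 1 / ∏ j, (n.1 j : ℝ) ^ 2) (oddESymm N M) := by
  induction N generalizing M with
  | zero =>
    have : Unique (OddChain 0 (Set.Iio M)) :=
      { default := ⟨Fin.elim0, fun i => i.elim0, fun i => i.elim0⟩
        uniq := fun a => Subtype.ext (funext fun i => i.elim0) }
    simp [oddESymm]
  | succ N ih =>
    have hsum : HasSum (fun m : Set.Iio M =>
        1 / (2 * ((m : ℕ) : ℝ) + 1) ^ 2 * oddESymm N m) (oddESymm (N + 1) M) := by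
      have h := (range M).hasSum fun k : ℕ => 1 / (2 * (k : ℝ) + 1) ^ 2 * oddESymm N k
      have hset : (range M : Set ℕ) = Set.Iio M := by simp
      simp only [oddESymm, div_eq_mul_one_div (oddESymm N _), mul_comm (oddESymm N _)]
      rw [← hset]
      exact h
    have h := OddChain.hasSum_cons (isLowerSet_Iio M)
      (f := fun n => 1 / ∏ j, (n j : ℝ) ^ 2) (g := fun m => 1 / (2 * (m : ℝ) + 1) ^ 2)
      (fun n => by positivity) (fun m => by positivity) ih hsum
    convert! h using 2 with n
    obtain ⟨m, -, hm⟩ := n.2.2 0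
    rw [Fin.prod_univ_succ, one_div_mul_one_div, hm, show (2 * m + 1) / 2 = m by omega]
    simp [Fin.tail]

/-- Peeling off the largest entry turns `t(3, {2}^N)` into a single sum over odd numbers. -/
lemma hasSum_mtvTerm_threeTwos (N : ℕ) :
    HasSum (mtvTerm (threeTwos N)) (∑' M : ℕ, oddESymm N M / (2 * (M : ℝ) + 1) ^ 3) := by
  have hsum : HasSum (fun m : (Set.univ : Set ℕ) =>
      1 / (2 * ((m : ℕ) : ℝ) + 1) ^ 3 * oddESymm N m)
      (∑' M : ℕ, oddESymm N M / (2 * (M : ℝ) + 1) ^ 3) := by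
    rw [← (Equiv.Set.univ ℕ).symm.hasSum_iff]
    simpa [Function.comp_def, div_eq_mul_one_div (oddESymm N _), mul_comm (oddESymm N _)] using
      (summable_oddESymm_div_cube N).hasSum
  have h := OddChain.hasSum_cons isLowerSet_univ
    (f := fun n => 1 / ∏ j, (n j : ℝ) ^ 2) (g := fun m => 1 / (2 * (m : ℝ) + 1) ^ 3)
    (fun n => by positivity) (fun m => by positivity) (OddChain.hasSum_twos N) hsum
  let e : MtvIndex (N + 1) ≃ OddChain (N + 1) Set.univ :=
    Equiv.subtypeEquivRight fun n => by simp [Odd]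
  rw [← e.hasSum_iff] at h
  convert! h using 1
  funext n
  obtain ⟨m, hm⟩ := n.2.2 0
  have he : (e n).1 = n.1 := rfl
  simp only [Function.comp_def, he, mtvTerm]
  rw [Fin.prod_univ_succ, one_div_mul_one_div, hm, show (2 * m + 1) / 2 = m by omega]
  simp [Fin.tail, threeTwos]

/-! ### Powers of an angle as series in odd powers of its sine -/

/-- The coefficient `(2 * M)! / (4 ^ M * M ! ^ 2 * (2 * M + 1))` of `y ^ (2 * M + 1)` in the
Taylor series of `arcsin y`, defined by its recursion. -/
noncomputable def arcsinCoeff : ℕ → ℝ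
  | 0 => 1
  | M + 1 => (2 * (M : ℝ) + 1) ^ 2 / ((2 * M + 3) * (2 * M + 2)) * arcsinCoeff M

lemma arcsinCoeff_nonneg (M : ℕ) : 0 ≤ arcsinCoeff M := by
  induction M with
  | zero => simp [arcsinCoeff]
  | succ M ih => exact mul_nonneg (by positivity) ih

lemma arcsinCoeff_le_one (M : ℕ) : arcsinCoeff M ≤ 1 := by
  induction M with
  | zero => simp [arcsinCoeff]
  | succ M ih =>
    refine mul_le_one₀ ((div_le_one (by positivity)).2 ?_) (arcsinCoeff_nonneg M) ih
    have : (0 : ℝ) ≤ M := M.cast_nonneg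
    nlinarith

/-- The second primitive of `sin ^ n` vanishing at `0` together with its derivative. -/
noncomputable def sinPowPrimitive (n : ℕ) (θ : ℝ) : ℝ :=
  ∫ s in 0..θ, (θ - s) * Real.sin s ^ n

lemma sinPowPrimitive_one (θ : ℝ) : sinPowPrimitive 1 θ = θ - Real.sin θ := by
  have hd : ∀ s ∈ Set.uIcc 0 θ, HasDerivAt (fun s => -(θ - s) * Real.cos s - Real.sin s)
      ((θ - s) * Real.sin s ^ 1) s := fun s _ => by
    convert! ((((hasDerivAt_id s).const_sub θ).neg).mul (Real.hasDerivAt_cos s)).sub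
      (Real.hasDerivAt_sin s) using 1
    simp only [id, Pi.neg_apply]
    ring
  rw [sinPowPrimitive, integral_eq_sub_of_hasDerivAt hd
    ((by fun_prop : Continuous _).intervalIntegrable _ _)]
  simp; ring

lemma sin_pow_add_two_eq (n : ℕ) (θ : ℝ) :
    Real.sin θ ^ (n + 2) = (n + 2) * (n + 1) * sinPowPrimitive n θ
      - (n + 2) ^ 2 * sinPowPrimitive (n + 2) θ := by
  have hd : ∀ s ∈ Set.uIcc 0 θ, HasDerivAt
      (fun s => (θ - s) * ((n + 2) * Real.sin s ^ (n + 1) * Real.cos s) + Real.sin s ^ (n + 2))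
      ((n + 2) * (n + 1) * ((θ - s) * Real.sin s ^ n)
        - (n + 2) ^ 2 * ((θ - s) * Real.sin s ^ (n + 2))) s := fun s _ => by
    convert! (((hasDerivAt_id s).const_sub θ).mul
      ((((Real.hasDerivAt_sin s).pow (n + 1)).const_mul ((n : ℝ) + 2)).mul
        (Real.hasDerivAt_cos s))).add ((Real.hasDerivAt_sin s).pow (n + 2)) using 1
    have h := Real.sin_sq_add_cos_sq s
    simp only [Nat.add_sub_cancel, id, Pi.mul_apply, Pi.pow_apply, Nat.cast_add,
      Nat.cast_one, Nat.cast_ofNat,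
      show n + 2 - 1 = n + 1 by omega]
    linear_combination (-((θ - s) * (n + 2) * (n + 1) * Real.sin s ^ n)) * h
  have h := integral_eq_sub_of_hasDerivAt hd ((by fun_prop : Continuous _).intervalIntegrable _ _)
  rw [integral_sub ((by fun_prop : Continuous _).intervalIntegrable _ _)
    ((by fun_prop : Continuous _).intervalIntegrable _ _),
    intervalIntegral.integral_const_mul, intervalIntegral.integral_const_mul] at h
  simp only [sinPowPrimitive]
  rw [h]
  simp

lemma sinPowPrimitive_nonneg (n : ℕ) {θ : ℝ} (h0 : 0 ≤ θ) (h1 : θ < Real.pi / 2) :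
    0 ≤ sinPowPrimitive n θ :=
  integral_nonneg h0 fun s hs => mul_nonneg (by linarith [hs.2])
    (pow_nonneg (Real.sin_nonneg_of_nonneg_of_le_pi hs.1 (by linarith [hs.2, Real.pi_pos])) _)

lemma sinPowPrimitive_le (n : ℕ) {θ : ℝ} (h0 : 0 ≤ θ) (h1 : θ < Real.pi / 2) :
    sinPowPrimitive n θ ≤ θ ^ 2 * Real.sin θ ^ n := by
  have h : sinPowPrimitive n θ ≤ ∫ _ in 0..θ, θ * Real.sin θ ^ n := by
    refine integral_mono_on h0 ((by fun_prop : Continuous _).intervalIntegrable _ _)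
      ((by fun_prop : Continuous _).intervalIntegrable _ _) fun s hs => ?_
    have hs0 := Real.sin_nonneg_of_nonneg_of_le_pi hs.1 (by linarith [hs.2, Real.pi_pos])
    have hs1 : Real.sin s ≤ Real.sin θ :=
      Real.sin_le_sin_of_le_of_le_pi_div_two (by linarith [hs.1, Real.pi_pos]) h1.le hs.2
    exact mul_le_mul (by linarith [hs.1]) (pow_le_pow_left₀ hs0 hs1 n) (pow_nonneg hs0 n) h0
  refine h.trans (le_of_eq ?_)
  simp; ring

lemma arcsinCoeff_succ_mul_sin_pow (M : ℕ) (θ : ℝ) :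
    arcsinCoeff (M + 1) * Real.sin θ ^ (2 * (M + 1) + 1)
      = (2 * (M : ℝ) + 1) ^ 2 * arcsinCoeff M * sinPowPrimitive (2 * M + 1) θ
        - (2 * ((M + 1 : ℕ) : ℝ) + 1) ^ 2 * arcsinCoeff (M + 1)
          * sinPowPrimitive (2 * (M + 1) + 1) θ := by
  have h := sin_pow_add_two_eq (2 * M + 1) θ
  rw [show 2 * (M + 1) + 1 = 2 * M + 1 + 2 by ring, h]
  have : (2 * (M : ℝ) + 3) ≠ 0 := by positivity
  have : (2 * (M : ℝ) + 2) ≠ 0 := by positivity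
  simp only [arcsinCoeff]
  push_cast
  field_simp
  ring

lemma sum_arcsinCoeff_mul_sin_pow (K : ℕ) (θ : ℝ) :
    ∑ M ∈ range (K + 1), arcsinCoeff M * oddESymm 0 M * Real.sin θ ^ (2 * M + 1)
      = θ - (2 * (K : ℝ) + 1) ^ 2 * arcsinCoeff K * oddESymm 0 (K + 1)
        * sinPowPrimitive (2 * K + 1) θ := by
  induction K with
  | zero => simp [arcsinCoeff, oddESymm, sinPowPrimitive_one]
  | succ K ih =>
    rw [sum_range_succ, ih]
    simp only [oddESymm, mul_one]
    rw [arcsinCoeff_succ_mul_sin_pow]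
    ring

/-- Abel summation against the identity for the second primitives of `sin ^ n`. -/
lemma sum_arcsinCoeff_mul_oddESymm_succ (N K : ℕ) (θ : ℝ) :
    ∑ M ∈ range (K + 1), arcsinCoeff M * oddESymm (N + 1) M * Real.sin θ ^ (2 * M + 1)
      = ∑ M ∈ range (K + 1), arcsinCoeff M * oddESymm N M * sinPowPrimitive (2 * M + 1) θ
        - (2 * (K : ℝ) + 1) ^ 2 * arcsinCoeff K * oddESymm (N + 1) (K + 1)
          * sinPowPrimitive (2 * K + 1) θ := by
  induction K with
  | zero => simp [arcsinCoeff, oddESymm]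
  | succ K ih =>
    rw [sum_range_succ, ih, sum_range_succ _ (K + 1), mul_right_comm (arcsinCoeff (K + 1)),
      arcsinCoeff_succ_mul_sin_pow, oddESymm_succ_succ N (K + 1)]
    have : (2 * ((K + 1 : ℕ) : ℝ) + 1) ≠ 0 := by positivity
    field_simp
    ring

lemma tendsto_sinPowPrimitive_remainder (N : ℕ) {θ : ℝ} (h0 : 0 ≤ θ) (h1 : θ < Real.pi / 2) :
    Tendsto (fun K : ℕ => (2 * (K : ℝ) + 1) ^ 2 * arcsinCoeff K * oddESymm N (K + 1)
        * sinPowPrimitive (2 * K + 1) θ) atTop (𝓝 0) := by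
  obtain ⟨C, hC, hle⟩ := exists_oddESymm_le N
  have hs0 : 0 ≤ Real.sin θ :=
    Real.sin_nonneg_of_nonneg_of_le_pi h0 (by linarith [Real.pi_pos])
  have hs1 : Real.sin θ < 1 := by
    rw [← Real.sin_pi_div_two]
    exact Real.sin_lt_sin_of_lt_of_le_pi_div_two (by linarith [Real.pi_pos]) le_rfl h1
  have hlim := ((tendsto_pow_const_mul_const_pow_of_abs_lt_one 2
    (by rwa [abs_of_nonneg hs0] : |Real.sin θ| < 1)).comp
      (tendsto_atTop_mono (fun n : ℕ => (by omega : n ≤ 2 * n + 1)) tendsto_id)).const_mul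
        (C * θ ^ 2)
  rw [mul_zero] at hlim
  refine squeeze_zero (fun K => ?_) (fun K => ?_) hlim
  · have := arcsinCoeff_nonneg K
    have := oddESymm_nonneg N (K + 1)
    have := sinPowPrimitive_nonneg (2 * K + 1) h0 h1
    positivity
  · calc (2 * (K : ℝ) + 1) ^ 2 * arcsinCoeff K * oddESymm N (K + 1)
          * sinPowPrimitive (2 * K + 1) θ
        ≤ (2 * (K : ℝ) + 1) ^ 2 * 1 * C * (θ ^ 2 * Real.sin θ ^ (2 * K + 1)) := by
          gcongr
          · exact sinPowPrimitive_nonneg _ h0 h1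
          · exact oddESymm_nonneg N _
          · exact arcsinCoeff_le_one K
          · exact hle _
          · exact sinPowPrimitive_le _ h0 h1
      _ = _ := by
          simp only [Function.comp]
          push_cast
          ring

lemma integral_sub_mul_pow_div_factorial (n : ℕ) (θ : ℝ) :
    ∫ s in 0..θ, (θ - s) * (s ^ n / n.factorial) = θ ^ (n + 2) / (n + 2).factorial := by
  have hd : ∀ s ∈ Set.uIcc 0 θ, HasDerivAt
      (fun s => (θ - s) * (s ^ (n + 1) / (n + 1).factorial) + s ^ (n + 2) / (n + 2).factorial)
      ((θ - s) * (s ^ n / n.factorial)) s := fun s _ => by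
    convert! (((hasDerivAt_id s).const_sub θ).mul
      ((hasDerivAt_pow (n + 1) s).div_const ((n + 1).factorial : ℝ))).add
      ((hasDerivAt_pow (n + 2) s).div_const ((n + 2).factorial : ℝ)) using 1
    have : (n.factorial : ℝ) ≠ 0 := by positivity
    have : (n : ℝ) + 1 ≠ 0 := by positivity
    have : (n : ℝ) + 1 + 1 ≠ 0 := by positivity
    simp only [Nat.factorial_succ, Nat.add_sub_cancel, id, show n + 2 - 1 = n + 1 by omega]
    push_cast
    field_simp
    ring
  rw [integral_eq_sub_of_hasDerivAt hd ((by fun_prop : Continuous _).intervalIntegrable _ _)]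
  simp

/-- Powers of an angle in terms of its sine: the coefficients of the Taylor series of
`arcsin y ^ (2 * N + 1) / (2 * N + 1)!` are those of `arcsin y` times truncated sums. Integrating
the series for `N` twice and regrouping gives the one for `N + 1`. -/
lemma hasSum_sin_pow_eq_pow_div_factorial (N : ℕ) {θ : ℝ} (h0 : 0 ≤ θ) (h1 : θ < Real.pi / 2) :
    HasSum (fun M : ℕ => arcsinCoeff M * oddESymm N M * Real.sin θ ^ (2 * M + 1))
      (θ ^ (2 * N + 1) / (2 * N + 1).factorial) := by
  have hnonneg : ∀ N M : ℕ, ∀ s, 0 ≤ s → s < Real.pi / 2 →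
      0 ≤ arcsinCoeff M * oddESymm N M * Real.sin s ^ (2 * M + 1) := fun N M s hs hs' =>
    mul_nonneg (mul_nonneg (arcsinCoeff_nonneg M) (oddESymm_nonneg N M))
      (pow_nonneg (Real.sin_nonneg_of_nonneg_of_le_pi hs (by linarith [Real.pi_pos])) _)
  induction N generalizing θ with
  | zero =>
    rw [hasSum_iff_tendsto_nat_of_nonneg fun M => hnonneg 0 M θ h0 h1,
      ← tendsto_add_atTop_iff_nat 1]
    simp_rw [sum_arcsinCoeff_mul_sin_pow]
    simpa using (tendsto_sinPowPrimitive_remainder 0 h0 h1).const_sub θ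
  | succ N ih =>
    have hprim : HasSum (fun M : ℕ => arcsinCoeff M * oddESymm N M
        * sinPowPrimitive (2 * M + 1) θ)
        (θ ^ (2 * (N + 1) + 1) / (2 * (N + 1) + 1).factorial) := by
      have hF : ∀ M : ℕ, ∫ s in Set.Ioc 0 θ,
          (θ - s) * (arcsinCoeff M * oddESymm N M * Real.sin s ^ (2 * M + 1))
          = arcsinCoeff M * oddESymm N M * sinPowPrimitive (2 * M + 1) θ := fun M => by
        rw [← intervalIntegral.integral_of_le h0, sinPowPrimitive,
          ← intervalIntegral.integral_const_mul]
        congr 1; ext s; ring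
      have hnorm : ∀ M : ℕ, ∫ s in Set.Ioc 0 θ,
          ‖(θ - s) * (arcsinCoeff M * oddESymm N M * Real.sin s ^ (2 * M + 1))‖
          = arcsinCoeff M * oddESymm N M * sinPowPrimitive (2 * M + 1) θ := fun M => by
        rw [← hF]
        refine setIntegral_congr_fun measurableSet_Ioc fun s hs => Real.norm_of_nonneg ?_
        exact mul_nonneg (by linarith [hs.2])
          (hnonneg N M s hs.1.le (by linarith [hs.2]))
      have hsum : Summable fun M : ℕ => arcsinCoeff M * oddESymm N M
          * sinPowPrimitive (2 * M + 1) θ := by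
        refine ((ih h0 h1).summable.mul_left (θ ^ 2)).of_nonneg_of_le (fun M => ?_) fun M => ?_
        · exact mul_nonneg (mul_nonneg (arcsinCoeff_nonneg M) (oddESymm_nonneg N M))
            (sinPowPrimitive_nonneg _ h0 h1)
        · rw [mul_left_comm]
          exact mul_le_mul_of_nonneg_left (sinPowPrimitive_le _ h0 h1)
            (mul_nonneg (arcsinCoeff_nonneg M) (oddESymm_nonneg N M))
      have h := hasSum_integral_of_summable_integral_norm
        (μ := volume.restrict (Set.Ioc 0 θ))
        (F := fun (M : ℕ) s =>
          (θ - s) * (arcsinCoeff M * oddESymm N M * Real.sin s ^ (2 * M + 1)))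
        (fun M => ((by fun_prop : Continuous _).intervalIntegrable 0 θ).1)
        (by simpa only [hnorm] using hsum)
      simp only [hF] at h
      convert! h using 1
      rw [show 2 * (N + 1) + 1 = 2 * N + 1 + 2 by ring, ← integral_sub_mul_pow_div_factorial,
        intervalIntegral.integral_of_le h0]
      refine setIntegral_congr_fun measurableSet_Ioc fun s hs => ?_
      exact ((ih hs.1.le (by linarith [hs.2])).mul_left (θ - s)).tsum_eq.symm
    rw [hasSum_iff_tendsto_nat_of_nonneg fun M => hnonneg (N + 1) M θ h0 h1,
      ← tendsto_add_atTop_iff_nat 1]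
    simp_rw [sum_arcsinCoeff_mul_oddESymm_succ]
    simpa using ((tendsto_add_atTop_iff_nat 1).2 hprim.tendsto_sum_nat).sub
      (tendsto_sinPowPrimitive_remainder (N + 1) h0 h1)

/-! ### The integral representation -/

lemma arcsinCoeff_mul_integral_sin_pow (M : ℕ) :
    arcsinCoeff M * ∫ θ in 0..(Real.pi / 2), Real.sin θ ^ (2 * M + 1)
      = 1 / (2 * (M : ℝ) + 1) ^ 2 := by
  induction M with
  | zero => simp [arcsinCoeff]
  | succ M ih =>
    rw [show 2 * (M + 1) + 1 = 2 * M + 1 + 2 by ring, integral_sin_pow]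
    have h2 : (2 * (M : ℝ) + 2) ≠ 0 := by positivity
    have h3 : (2 * (M : ℝ) + 3) ≠ 0 := by positivity
    generalize (∫ θ in 0..(Real.pi / 2), Real.sin θ ^ (2 * M + 1)) = J at ih ⊢
    rw [eq_div_iff (by positivity)] at ih ⊢
    refine Eq.trans ?_ ih
    simp only [arcsinCoeff, Real.sin_zero, Real.cos_pi_div_two, mul_zero, sub_zero,
      zero_pow (Nat.succ_ne_zero _), zero_mul, zero_div, zero_add]
    push_cast
    rw [show 2 * (M : ℝ) + 1 + 2 = 2 * M + 3 by ring]
    field_simp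
    ring

lemma integral_sub_mul_cos_mul_sin_pow (n : ℕ) :
    ∫ θ in 0..(Real.pi / 2), (Real.pi / 2 - θ) * Real.cos θ * Real.sin θ ^ n
      = 1 / (n + 1) * ∫ θ in 0..(Real.pi / 2), Real.sin θ ^ (n + 1) := by
  have hn : (n : ℝ) + 1 ≠ 0 := by positivity
  have hd : ∀ s ∈ Set.uIcc 0 (Real.pi / 2), HasDerivAt
      (fun s => (Real.pi / 2 - s) * (Real.sin s ^ (n + 1) / (n + 1)))
      ((Real.pi / 2 - s) * Real.cos s * Real.sin s ^ n
        - 1 / (n + 1) * Real.sin s ^ (n + 1)) s := fun s _ => by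
    convert! ((hasDerivAt_id s).const_sub (Real.pi / 2)).mul
      (((Real.hasDerivAt_sin s).pow (n + 1)).div_const ((n : ℝ) + 1)) using 1
    simp only [Nat.add_sub_cancel, id, Pi.pow_apply, Nat.cast_add, Nat.cast_one]
    field_simp
    ring
  have h := integral_eq_sub_of_hasDerivAt hd ((by fun_prop : Continuous _).intervalIntegrable _ _)
  rw [integral_sub ((by fun_prop : Continuous _).intervalIntegrable _ _)
    ((by fun_prop : Continuous _).intervalIntegrable _ _),
    intervalIntegral.integral_const_mul] at h
  simpa [sub_eq_zero] using h

/-- The function `(π / 2 - θ) θ ^ (2 * N + 1) / ((2 * N + 1)! sin θ)`, extended continuously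
to `θ = 0`. -/
noncomputable def cscKernel (N : ℕ) (θ : ℝ) : ℝ :=
  (Real.pi / 2 - θ) * (θ ^ (2 * N) / (2 * N + 1).factorial) / Real.sinc θ

lemma sinc_pos {θ : ℝ} (h0 : 0 ≤ θ) (h1 : θ ≤ Real.pi / 2) : 0 < Real.sinc θ := by
  rcases h0.eq_or_lt with rfl | h
  · simp
  · rw [Real.sinc_of_ne_zero h.ne']
    exact div_pos (Real.sin_pos_of_pos_of_lt_pi h (by linarith [Real.pi_pos])) h

lemma continuousOn_cscKernel (N : ℕ) : ContinuousOn (cscKernel N) (Set.Icc 0 (Real.pi / 2)) :=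
  ContinuousOn.div (by fun_prop) Real.continuous_sinc.continuousOn
    fun _ hθ => (sinc_pos hθ.1 hθ.2).ne'

lemma cscKernel_mul_sin (N : ℕ) {θ : ℝ} (h0 : 0 ≤ θ) (h1 : θ ≤ Real.pi / 2) :
    cscKernel N θ * Real.sin θ
      = (Real.pi / 2 - θ) * (θ ^ (2 * N + 1) / (2 * N + 1).factorial) := by
  rcases h0.eq_or_lt with rfl | h
  · simp
  · have hs := Real.sin_pos_of_pos_of_lt_pi h (by linarith [Real.pi_pos])
    rw [cscKernel, Real.sinc_of_ne_zero h.ne']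
    field_simp
    ring

/-- The single sum for `t(3, {2}^N)` is the integral of
`(π / 2 - θ) cot θ · θ ^ (2 * N + 1) / (2 * N + 1)!` over `[0, π / 2]`. -/
lemma hasSum_oddESymm_div_cube (N : ℕ) :
    HasSum (fun M : ℕ => oddESymm N M / (2 * (M : ℝ) + 1) ^ 3)
      (∫ θ in 0..(Real.pi / 2), cscKernel N θ * Real.cos θ) := by
  have hpi : 0 ≤ Real.pi / 2 := by positivity
  have hF : ∀ M : ℕ, ∫ s in Set.Ioo 0 (Real.pi / 2), arcsinCoeff M * oddESymm N M *
      ((Real.pi / 2 - s) * Real.cos s * Real.sin s ^ (2 * M))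
      = oddESymm N M / (2 * (M : ℝ) + 1) ^ 3 := fun M => by
    rw [← integral_Ioc_eq_integral_Ioo, ← intervalIntegral.integral_of_le hpi,
      intervalIntegral.integral_const_mul, integral_sub_mul_cos_mul_sin_pow]
    have h := arcsinCoeff_mul_integral_sin_pow M
    have h1 : (2 * (M : ℝ) + 1) ≠ 0 := by positivity
    rw [eq_div_iff (by positivity)] at h ⊢
    push_cast
    field_simp
    linear_combination oddESymm N M * h
  have hnorm : ∀ M : ℕ, ∫ s in Set.Ioo 0 (Real.pi / 2), ‖arcsinCoeff M * oddESymm N M *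
      ((Real.pi / 2 - s) * Real.cos s * Real.sin s ^ (2 * M))‖
      = oddESymm N M / (2 * (M : ℝ) + 1) ^ 3 := fun M => by
    rw [← hF]
    refine setIntegral_congr_fun measurableSet_Ioo fun s hs => Real.norm_of_nonneg ?_
    have h1 : 0 ≤ Real.cos s :=
      Real.cos_nonneg_of_neg_pi_div_two_le_of_le (by linarith [hs.1]) hs.2.le
    have h2 := Real.sin_nonneg_of_nonneg_of_le_pi hs.1.le (by linarith [hs.2])
    have h3 : 0 ≤ Real.pi / 2 - s := by linarith [hs.2]
    have h4 := arcsinCoeff_nonneg M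
    have h5 := oddESymm_nonneg N M
    positivity
  have h := hasSum_integral_of_summable_integral_norm
    (μ := volume.restrict (Set.Ioo 0 (Real.pi / 2)))
    (F := fun (M : ℕ) s => arcsinCoeff M * oddESymm N M *
      ((Real.pi / 2 - s) * Real.cos s * Real.sin s ^ (2 * M)))
    (fun M => (((by fun_prop : Continuous _).intervalIntegrable 0 (Real.pi / 2)).1).mono_set
      Set.Ioo_subset_Ioc_self)
    (by simpa only [hnorm] using summable_oddESymm_div_cube N)
  simp only [hF] at h
  convert! h using 1
  rw [intervalIntegral.integral_of_le hpi, integral_Ioc_eq_integral_Ioo]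
  refine setIntegral_congr_fun measurableSet_Ioo fun s hs => ?_
  have hs0 : Real.sin s ≠ 0 :=
    (Real.sin_pos_of_pos_of_lt_pi hs.1 (by linarith [hs.2])).ne'
  have hk := cscKernel_mul_sin N hs.1.le hs.2.le
  have hs' := (hasSum_sin_pow_eq_pow_div_factorial N hs.1.le hs.2).mul_left
    ((Real.pi / 2 - s) * Real.cos s / Real.sin s)
  have hval : cscKernel N s * Real.cos s = (Real.pi / 2 - s) * Real.cos s / Real.sin s *
      (s ^ (2 * N + 1) / (2 * N + 1).factorial) := by
    rw [eq_comm, div_mul_eq_mul_div, div_eq_iff hs0]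
    linear_combination -Real.cos s * hk
  rw [hval, ← hs'.tsum_eq]
  refine tsum_congr fun M => ?_
  field_simp
  ring

/-! ### Expansion of the cotangent -/

lemma tendsto_integral_mul_cos_odd (f : ℝ → ℝ) {a b : ℝ} (hab : a ≤ b)
    (hf : ContinuousOn f (Set.Icc a b)) :
    Tendsto (fun K : ℕ => ∫ θ in a..b, f θ * Real.cos ((2 * K + 1) * θ)) atTop (𝓝 0) := by
  have hR := Real.tendsto_integral_exp_smul_cocompact
    ((Set.Ioc a b).indicator fun θ => (f θ : ℂ))
  have hw : Tendsto (fun K : ℕ => (2 * (K : ℝ) + 1) / (2 * Real.pi)) atTop (cocompact ℝ) := by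
    refine Tendsto.mono_right ?_ atTop_le_cocompact
    refine Tendsto.atTop_div_const (by positivity) (tendsto_atTop_add_const_right _ _ ?_)
    exact tendsto_natCast_atTop_atTop.const_mul_atTop two_pos
  have h := (Complex.continuous_re.tendsto _).comp (hR.comp hw)
  rw [Complex.zero_re] at h
  refine h.congr fun K => ?_
  simp only [Function.comp]
  have hind : ∀ v : ℝ, Real.fourierChar (-(v * ((2 * (K : ℝ) + 1) / (2 * Real.pi)))) •
      (Set.Ioc a b).indicator (fun θ => (f θ : ℂ)) v = (Set.Ioc a b).indicator
        (fun θ : ℝ => Complex.exp (((-((2 * K + 1) * θ) : ℝ) : ℂ) * Complex.I) * (f θ : ℂ)) v := by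
    intro v
    by_cases hv : v ∈ Set.Ioc a b
    · simp only [Set.indicator_of_mem hv, Circle.smul_def, smul_eq_mul, Real.fourierChar_apply]
      congr 4
      have := Real.pi_ne_zero
      field_simp
    · simp [Set.indicator_of_notMem hv]
  simp only [hind]
  have hint : IntegrableOn (fun θ : ℝ =>
      Complex.exp (((-((2 * K + 1) * θ) : ℝ) : ℂ) * Complex.I) * (f θ : ℂ)) (Set.Ioc a b) := by
    refine (ContinuousOn.integrableOn_Icc ?_).mono_set Set.Ioc_subset_Icc_self
    exact ContinuousOn.mul (by fun_prop) (Complex.continuous_ofReal.comp_continuousOn hf)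
  rw [MeasureTheory.integral_indicator measurableSet_Ioc,
    intervalIntegral.integral_of_le hab]
  have hre := integral_re hint
  simp only [RCLike.re_eq_complex_re] at hre
  rw [← hre]
  refine setIntegral_congr_fun measurableSet_Ioc fun θ _ => ?_
  rw [Complex.re_mul_ofReal, Complex.exp_ofReal_mul_I_re, Real.cos_neg, mul_comm]

lemma sin_mul_sum_sin (K : ℕ) (θ : ℝ) :
    Real.sin θ * ∑ k ∈ range K, 2 * Real.sin (2 * (k + 1) * θ)
      = Real.cos θ - Real.cos ((2 * K + 1) * θ) := by
  induction K with
  | zero => simp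
  | succ K ih =>
    rw [sum_range_succ, mul_add, ih]
    have h1 : (2 * (K : ℝ) + 1) * θ = 2 * (K + 1) * θ - θ := by ring
    have h2 : (2 * ((K + 1 : ℕ) : ℝ) + 1) * θ = 2 * (K + 1) * θ + θ := by push_cast; ring
    rw [h1, h2, Real.cos_sub, Real.cos_add]
    ring

/-- The integral of `cscKernel N θ * cos θ` evaluated by means of `cot θ = ∑ 2 sin (2 k θ)`, which
holds in the weak sense provided by the Riemann–Lebesgue lemma. -/
lemma tendsto_sum_integral_sin (N : ℕ) :
    Tendsto (fun K : ℕ => ∑ k ∈ range K, 2 * ∫ θ in 0..(Real.pi / 2),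
        (Real.pi / 2 - θ) * (θ ^ (2 * N + 1) / (2 * N + 1).factorial)
          * Real.sin (2 * (k + 1) * θ)) atTop
      (𝓝 (∫ θ in 0..(Real.pi / 2), cscKernel N θ * Real.cos θ)) := by
  have hpi : 0 ≤ Real.pi / 2 := by positivity
  have hcont := continuousOn_cscKernel N
  have h := (tendsto_integral_mul_cos_odd _ hpi hcont).const_sub
    (∫ θ in 0..(Real.pi / 2), cscKernel N θ * Real.cos θ)
  rw [sub_zero] at h
  refine h.congr fun K => ?_
  have hcos : ∀ c : ℝ, IntervalIntegrable (fun θ => cscKernel N θ * Real.cos (c * θ)) volume 0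
      (Real.pi / 2) := fun c =>
    ContinuousOn.intervalIntegrable_of_Icc hpi (hcont.mul (by fun_prop))
  rw [← integral_sub (by simpa using hcos 1) (hcos _)]
  simp_rw [← intervalIntegral.integral_const_mul]
  rw [← intervalIntegral.integral_finsetSum
    fun k _ => (by fun_prop : Continuous _).intervalIntegrable _ _]
  refine integral_congr fun θ hθ => ?_
  rw [Set.uIcc_of_le hpi] at hθ
  rw [← mul_sub, ← sin_mul_sum_sin, ← mul_assoc, cscKernel_mul_sin N hθ.1 hθ.2, mul_sum]
  exact sum_congr rfl fun k _ => by ring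

/-! ### Moments of the sine -/

lemma cos_two_mul_succ_mul_pi_div_two (k : ℕ) :
    Real.cos (2 * ((k : ℝ) + 1) * (Real.pi / 2)) = -(-1) ^ k := by
  rw [show 2 * ((k : ℝ) + 1) * (Real.pi / 2) = ((k + 1 : ℕ) : ℝ) * Real.pi by push_cast; ring,
    Real.cos_nat_mul_pi, pow_succ]
  ring

lemma sin_two_mul_succ_mul_pi_div_two (k : ℕ) :
    Real.sin (2 * ((k : ℝ) + 1) * (Real.pi / 2)) = 0 := by
  rw [show 2 * ((k : ℝ) + 1) * (Real.pi / 2) = ((k + 1 : ℕ) : ℝ) * Real.pi by push_cast; ring,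
    Real.sin_nat_mul_pi]

/-- Integration by parts twice; the boundary terms use that `2 * (k + 1)` is even. -/
lemma integral_pow_add_two_mul_sin (m k : ℕ) :
    ∫ θ in 0..(Real.pi / 2), θ ^ (m + 2) / (m + 2).factorial * Real.sin (2 * (k + 1) * θ)
      = (-1) ^ k * ((Real.pi / 2) ^ (m + 2) / (m + 2).factorial) / (2 * ((k : ℝ) + 1))
        - (∫ θ in 0..(Real.pi / 2), θ ^ m / m.factorial * Real.sin (2 * (k + 1) * θ))
          / (2 * ((k : ℝ) + 1)) ^ 2 := by
  set c : ℝ := 2 * ((k : ℝ) + 1) with hc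
  have hc0 : c ≠ 0 := by positivity
  have hcos : Real.cos (c * (Real.pi / 2)) = -(-1) ^ k := cos_two_mul_succ_mul_pi_div_two k
  have hsin : Real.sin (c * (Real.pi / 2)) = 0 := sin_two_mul_succ_mul_pi_div_two k
  have hd : ∀ s ∈ Set.uIcc 0 (Real.pi / 2), HasDerivAt
      (fun s => s ^ (m + 1) / (m + 1).factorial * (Real.sin (c * s) / c ^ 2)
        - s ^ (m + 2) / (m + 2).factorial * (Real.cos (c * s) / c))
      (s ^ (m + 2) / (m + 2).factorial * Real.sin (c * s)
        + 1 / c ^ 2 * (s ^ m / m.factorial * Real.sin (c * s))) s := fun s _ => by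
    have hcs : HasDerivAt (fun s => c * s) c s := by
      simpa using (hasDerivAt_id s).const_mul c
    convert! (((hasDerivAt_pow (m + 1) s).div_const ((m + 1).factorial : ℝ)).mul
      (hcs.sin.div_const (c ^ 2))).sub
      (((hasDerivAt_pow (m + 2) s).div_const ((m + 2).factorial : ℝ)).mul
      (hcs.cos.div_const c)) using 1
    have : (m.factorial : ℝ) ≠ 0 := by positivity
    have : (m : ℝ) + 1 ≠ 0 := by positivity
    have : (m : ℝ) + 1 + 1 ≠ 0 := by positivity
    simp only [Nat.factorial_succ, Nat.add_sub_cancel, show m + 2 - 1 = m + 1 by omega]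
    push_cast
    field_simp
    ring
  have h := integral_eq_sub_of_hasDerivAt hd ((by fun_prop : Continuous _).intervalIntegrable _ _)
  rw [integral_add ((by fun_prop : Continuous _).intervalIntegrable _ _)
    ((by fun_prop : Continuous _).intervalIntegrable _ _),
    intervalIntegral.integral_const_mul, hcos, hsin] at h
  simp only [zero_pow (Nat.succ_ne_zero _), zero_div, zero_mul, mul_zero, sub_zero, zero_sub] at h
  rw [eq_sub_iff_add_eq, div_eq_mul_one_div _ (c ^ 2), mul_comm _ (1 / c ^ 2), h]
  ring

lemma integral_sin_two_mul (k : ℕ) :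
    ∫ θ in 0..(Real.pi / 2), Real.sin (2 * ((k : ℝ) + 1) * θ)
      = (1 + (-1) ^ k) / (2 * ((k : ℝ) + 1)) := by
  have hc0 : 2 * ((k : ℝ) + 1) ≠ 0 := by positivity
  rw [intervalIntegral.integral_comp_mul_left _ hc0, integral_sin,
    cos_two_mul_succ_mul_pi_div_two]
  simp
  field_simp

lemma integral_id_mul_sin_two_mul (k : ℕ) :
    ∫ θ in 0..(Real.pi / 2), θ * Real.sin (2 * ((k : ℝ) + 1) * θ)
      = (-1) ^ k * (Real.pi / 2) / (2 * ((k : ℝ) + 1)) := by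
  set c : ℝ := 2 * ((k : ℝ) + 1) with hc
  have hc0 : c ≠ 0 := by positivity
  have hcos : Real.cos (c * (Real.pi / 2)) = -(-1) ^ k := cos_two_mul_succ_mul_pi_div_two k
  have hsin : Real.sin (c * (Real.pi / 2)) = 0 := sin_two_mul_succ_mul_pi_div_two k
  have hd : ∀ s ∈ Set.uIcc 0 (Real.pi / 2), HasDerivAt
      (fun s => Real.sin (c * s) / c ^ 2 - s * (Real.cos (c * s) / c))
      (s * Real.sin (c * s)) s := fun s _ => by
    have hcs : HasDerivAt (fun s => c * s) c s := by
      simpa using (hasDerivAt_id s).const_mul c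
    convert! (hcs.sin.div_const (c ^ 2)).sub
      ((hasDerivAt_id s).mul (hcs.cos.div_const c)) using 1
    simp only [id]
    field_simp
    ring
  rw [integral_eq_sub_of_hasDerivAt hd ((by fun_prop : Continuous _).intervalIntegrable _ _),
    hcos, hsin]
  simp
  ring

lemma integral_pow_odd_mul_sin (N k : ℕ) :
    ∫ θ in 0..(Real.pi / 2), θ ^ (2 * N + 1) / (2 * N + 1).factorial
        * Real.sin (2 * (k + 1) * θ)
      = (-1) ^ k * ∑ r ∈ range (N + 1), (-1) ^ r
        * ((Real.pi / 2) ^ (2 * N + 1 - 2 * r) / (2 * N + 1 - 2 * r).factorial)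
        / (2 * ((k : ℝ) + 1)) ^ (2 * r + 1) := by
  induction N with
  | zero =>
    simp [integral_id_mul_sin_two_mul, mul_div_assoc]
  | succ N ih =>
    have hc0 : 2 * ((k : ℝ) + 1) ≠ 0 := by positivity
    rw [show 2 * (N + 1) + 1 = 2 * N + 1 + 2 by ring, integral_pow_add_two_mul_sin, ih,
      sum_range_succ' _ (N + 1), mul_add _ (∑ r ∈ range (N + 1), _), mul_sum, mul_sum,
      sub_eq_add_neg, add_comm, sum_div,
      ← sum_neg_distrib]
    congr 1
    · refine sum_congr rfl fun r _ => ?_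
      rw [show 2 * N + 1 + 2 - 2 * (r + 1) = 2 * N + 1 - 2 * r by omega]
      field_simp
      ring
    · simp [mul_div_assoc]

lemma integral_pow_even_mul_sin (N k : ℕ) :
    ∫ θ in 0..(Real.pi / 2), θ ^ (2 * N + 2) / (2 * N + 2).factorial
        * Real.sin (2 * (k + 1) * θ)
      = (-1) ^ k * ∑ r ∈ range (N + 1), (-1) ^ r
        * ((Real.pi / 2) ^ (2 * N + 2 - 2 * r) / (2 * N + 2 - 2 * r).factorial)
        / (2 * ((k : ℝ) + 1)) ^ (2 * r + 1)
        - (-1) ^ N * (1 + (-1) ^ k) / (2 * ((k : ℝ) + 1)) ^ (2 * N + 3) := by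
  have hc0 : 2 * ((k : ℝ) + 1) ≠ 0 := by positivity
  induction N with
  | zero =>
    rw [mul_zero, integral_pow_add_two_mul_sin]
    simp only [pow_zero, Nat.factorial_zero, Nat.cast_one, div_one, one_mul, integral_sin_two_mul]
    simp
    field_simp
  | succ N ih =>
    rw [show 2 * (N + 1) + 2 = 2 * N + 2 + 2 by ring, integral_pow_add_two_mul_sin, ih,
      sum_range_succ' _ (N + 1), mul_add _ (∑ r ∈ range (N + 1), _), mul_sum, mul_sum,
      sub_div, sum_div]
    have hterm : ∀ r, (-1) ^ k * ((-1) ^ (r + 1)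
        * ((Real.pi / 2) ^ (2 * N + 2 + 2 - 2 * (r + 1)) / (2 * N + 2 + 2 - 2 * (r + 1)).factorial)
        / (2 * ((k : ℝ) + 1)) ^ (2 * (r + 1) + 1))
        = -((-1) ^ k * ((-1) ^ r
        * ((Real.pi / 2) ^ (2 * N + 2 - 2 * r) / (2 * N + 2 - 2 * r).factorial)
        / (2 * ((k : ℝ) + 1)) ^ (2 * r + 1)) / (2 * ((k : ℝ) + 1)) ^ 2) := fun r => by
      rw [show 2 * N + 2 + 2 - 2 * (r + 1) = 2 * N + 2 - 2 * r by omega]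
      field_simp
      ring
    simp only [hterm, sum_neg_distrib]
    have hlast : (-1) ^ (N + 1) * (1 + (-1) ^ k) / (2 * ((k : ℝ) + 1)) ^ (2 * (N + 1) + 3)
        = -((-1) ^ N * (1 + (-1) ^ k) / (2 * ((k : ℝ) + 1)) ^ (2 * N + 3)
          / (2 * ((k : ℝ) + 1)) ^ 2) := by
      field_simp
      ring
    rw [hlast]
    simp only [mul_zero, Nat.sub_zero, pow_zero, one_mul, zero_add, pow_one, mul_div_assoc]
    ring

/-- The `k`-th term in the cotangent expansion of the integral representation. The factor `2 * r`
is the difference of `2 * N + 2` and the degree `2 * N + 2 - 2 * r` of the accompanying power, from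
`(π / 2 - θ) θ ^ (2 * N + 1) = (π / 2) θ ^ (2 * N + 1) - θ ^ (2 * N + 2)`. -/
lemma integral_sub_mul_pow_mul_sin (N k : ℕ) :
    ∫ θ in 0..(Real.pi / 2), (Real.pi / 2 - θ) * (θ ^ (2 * N + 1) / (2 * N + 1).factorial)
        * Real.sin (2 * (k + 1) * θ)
      = ∑ r ∈ Icc 1 N, (-1) ^ (r + 1) * (2 * (r : ℝ))
          * ((Real.pi / 2) ^ (2 * N + 2 - 2 * r) / (2 * N + 2 - 2 * r).factorial)
          * ((-1) ^ k / (2 * ((k : ℝ) + 1)) ^ (2 * r + 1))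
        + (-1) ^ N * (2 * (N : ℝ) + 2)
          * ((1 + (-1) ^ k) / (2 * ((k : ℝ) + 1)) ^ (2 * N + 3)) := by
  have hsplit : ∀ θ : ℝ, (Real.pi / 2 - θ) * (θ ^ (2 * N + 1) / (2 * N + 1).factorial)
        * Real.sin (2 * (k + 1) * θ)
      = Real.pi / 2 * (θ ^ (2 * N + 1) / (2 * N + 1).factorial * Real.sin (2 * (k + 1) * θ))
        - (2 * N + 2) * (θ ^ (2 * N + 2) / (2 * N + 2).factorial
          * Real.sin (2 * (k + 1) * θ)) := fun θ => by
    rw [Nat.factorial_succ (2 * N + 1)]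
    push_cast
    have : 2 * (N : ℝ) + 1 + 1 ≠ 0 := by positivity
    have : ((2 * N + 1).factorial : ℝ) ≠ 0 := by positivity
    field_simp
    ring
  simp only [hsplit]
  rw [integral_sub ((by fun_prop : Continuous _).intervalIntegrable _ _)
    ((by fun_prop : Continuous _).intervalIntegrable _ _),
    intervalIntegral.integral_const_mul, intervalIntegral.integral_const_mul,
    integral_pow_odd_mul_sin, integral_pow_even_mul_sin]
  -- the summand at `r = 0` vanishes
  have hrange : ∑ r ∈ Icc 1 N, (-1) ^ (r + 1) * (2 * (r : ℝ))
          * ((Real.pi / 2) ^ (2 * N + 2 - 2 * r) / (2 * N + 2 - 2 * r).factorial)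
          * ((-1) ^ k / (2 * ((k : ℝ) + 1)) ^ (2 * r + 1))
      = ∑ r ∈ range (N + 1), (-1) ^ (r + 1) * (2 * (r : ℝ))
          * ((Real.pi / 2) ^ (2 * N + 2 - 2 * r) / (2 * N + 2 - 2 * r).factorial)
          * ((-1) ^ k / (2 * ((k : ℝ) + 1)) ^ (2 * r + 1)) := by
    refine sum_subset (fun r hr => ?_) fun r hr hr' => ?_
    · simp only [mem_Icc, mem_range] at hr ⊢; omega
    · have : r = 0 := by simp only [mem_Icc, mem_range] at hr hr'; omega
      simp [this]
  have hsum : Real.pi / 2 * ((-1) ^ k * ∑ r ∈ range (N + 1), (-1) ^ r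
        * ((Real.pi / 2) ^ (2 * N + 1 - 2 * r) / (2 * N + 1 - 2 * r).factorial)
        / (2 * ((k : ℝ) + 1)) ^ (2 * r + 1))
      - (2 * N + 2) * ((-1) ^ k * ∑ r ∈ range (N + 1), (-1) ^ r
        * ((Real.pi / 2) ^ (2 * N + 2 - 2 * r) / (2 * N + 2 - 2 * r).factorial)
        / (2 * ((k : ℝ) + 1)) ^ (2 * r + 1))
      = ∑ r ∈ range (N + 1), (-1) ^ (r + 1) * (2 * (r : ℝ))
          * ((Real.pi / 2) ^ (2 * N + 2 - 2 * r) / (2 * N + 2 - 2 * r).factorial)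
          * ((-1) ^ k / (2 * ((k : ℝ) + 1)) ^ (2 * r + 1)) := by
    simp only [mul_sum]
    rw [← sum_sub_distrib]
    refine sum_congr rfl fun r hr => ?_
    obtain ⟨d, rfl⟩ := Nat.exists_eq_add_of_le (Nat.lt_succ_iff.1 (mem_range.1 hr))
    rw [show 2 * (r + d) + 1 - 2 * r = 2 * d + 1 by omega,
      show 2 * (r + d) + 2 - 2 * r = 2 * d + 1 + 1 by omega, Nat.factorial_succ (2 * d + 1)]
    push_cast
    have : 2 * (d : ℝ) + 1 + 1 ≠ 0 := by positivity
    have : ((2 * d + 1).factorial : ℝ) ≠ 0 := by positivity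
    field_simp
    ring
  rw [hrange, ← hsum]
  ring

/-! ### Zeta and eta values -/

lemma hasSum_riemannZeta_nat {m : ℕ} (hm : 2 ≤ m) :
    HasSum (fun k : ℕ => 1 / ((k : ℂ) + 1) ^ m) (riemannZeta m) := by
  have hs : Summable fun k : ℕ => 1 / ((k : ℂ) + 1) ^ m := by
    have h := (summable_nat_add_iff 1).2 ((Real.summable_one_div_nat_pow (p := m)).2 (by omega))
    have h' : Summable fun k : ℕ => (((1 / ((k + 1 : ℕ) : ℝ) ^ m : ℝ)) : ℂ) := by
      exact_mod_cast h
    simpa using h'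
  convert! hs.hasSum using 1
  have h := zeta_eq_tsum_one_div_nat_add_one_cpow (s := m) (by simp; omega)
  simpa using h

lemma hasSum_dirichletEta {m : ℕ} (hm : 2 ≤ m) :
    HasSum (fun k : ℕ => (-1) ^ k / ((k : ℂ) + 1) ^ m) (dirichletEta m) := by
  have hz := hasSum_riemannZeta_nat hm
  -- the terms with an even denominator `2 * k + 2`, at the odd indices `2 * k + 1`
  have heven : HasSum (fun k : ℕ => if Even k then (0 : ℂ) else 1 / ((k : ℂ) + 1) ^ m)
      (0 + 1 / 2 ^ m * riemannZeta m) := by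
    refine HasSum.even_add_odd ?_ ?_
    · simp
    · convert! hz.mul_left (1 / 2 ^ m : ℂ) using 1
      funext k
      have : ¬ Even (2 * k + 1) := by simp
      rw [if_neg this, one_div_mul_one_div, ← mul_pow]
      push_cast
      ring
  -- the alternating series is the full series minus twice the part with even denominators
  have h := hz.sub (heven.mul_left 2)
  convert! h using 1
  · funext k
    by_cases hk : Even k
    · simp [hk]
    · simp only [hk, if_false, (Nat.not_even_iff_odd.1 hk).neg_one_pow]
      ring
  · rw [dirichletEta, if_neg (by omega), zpow_sub₀ two_ne_zero, zpow_one, zpow_natCast]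
    ring

lemma dirichletEta_add_riemannZeta {m : ℕ} (hm : 2 ≤ m) :
    dirichletEta m + riemannZeta m = 2 * (1 - 1 / 2 ^ m) * riemannZeta m := by
  rw [dirichletEta, if_neg (by omega), zpow_sub₀ two_ne_zero, zpow_one, zpow_natCast]
  ring

theorem theorem2p6 (N : ℕ) (hN : 1 ≤ N) :
    Summable (mtvTerm (threeTwos N)) ∧
    (mtv (threeTwos N) : ℂ) =
      1 / 2 ^ (2 * N + 2) *
        (∑ j ∈ Finset.Icc 1 N,
            (-1 : ℂ) ^ (j + 1) * (2 * (j : ℂ)) * (Real.pi : ℂ) ^ (2 * N + 2 - 2 * j)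
              / (Nat.factorial (2 * N + 2 - 2 * j) : ℂ) * dirichletEta (2 * j + 1)
          + (-1 : ℂ) ^ N * 2 * (2 * (N : ℂ) + 2) * (1 - 1 / 2 ^ (2 * N + 3))
              * riemannZeta (2 * (N : ℂ) + 3)) := by
  have ht := hasSum_mtvTerm_threeTwos N
  refine ⟨ht.summable, ?_⟩
  rw [mtv, ht.tsum_eq, (hasSum_oddESymm_div_cube N).tsum_eq]
  have hlim := (Complex.continuous_ofReal.tendsto _).comp (tendsto_sum_integral_sin N)
  have hsum : HasSum (fun k : ℕ => ∑ r ∈ Icc 1 N, 2 * ((-1) ^ (r + 1) * (2 * (r : ℂ))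
          * (((Real.pi : ℂ) / 2) ^ (2 * N + 2 - 2 * r) / (2 * N + 2 - 2 * r).factorial)
          * (1 / 2 ^ (2 * r + 1))) * ((-1) ^ k / ((k : ℂ) + 1) ^ (2 * r + 1))
        + 2 * ((-1) ^ N * (2 * (N : ℂ) + 2) * (1 / 2 ^ (2 * N + 3)))
          * ((-1) ^ k / ((k : ℂ) + 1) ^ (2 * N + 3) + 1 / ((k : ℂ) + 1) ^ (2 * N + 3))) _ :=
    (hasSum_sum fun r hr => (hasSum_dirichletEta (m := 2 * r + 1)
      (by have := (mem_Icc.1 hr).1; omega)).mul_left _).add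
    (((hasSum_dirichletEta (m := 2 * N + 3) (by omega)).add
      (hasSum_riemannZeta_nat (m := 2 * N + 3) (by omega))).mul_left _)
  refine (tendsto_nhds_unique hlim (hsum.tendsto_sum_nat.congr fun K => ?_)).trans ?_
  · simp only [Function.comp]
    push_cast
    refine sum_congr rfl fun k _ => ?_
    rw [integral_sub_mul_pow_mul_sin]
    push_cast
    rw [mul_add _ (∑ r ∈ Icc 1 N, _), mul_sum]
    congr 1
    · refine sum_congr rfl fun r _ => ?_
      rw [mul_pow]
      field_simp
    · rw [mul_pow]
      field_simp
      ring
  · rw [dirichletEta_add_riemannZeta (by omega), mul_add _ (∑ r ∈ Icc 1 N, _), mul_sum]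
    congr 1
    · refine sum_congr rfl fun r hr => ?_
      obtain ⟨d, rfl⟩ := Nat.exists_eq_add_of_le (mem_Icc.1 hr).2
      rw [show 2 * (r + d) + 2 - 2 * r = 2 * d + 2 by omega, div_pow]
      field_simp
      ring
    · push_cast
      field_simp
      ring

end
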